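/- **Lemma (characteristic function of $T_\mu$).** Let $z_1,z_2$ be points of the open unit disc $\mathbb D$ (possibly equal) and let $\mu\in\mathbb C$ with $|\mu|\le 1$. Put $$T_\mu=\begin{pmatrix} z_1&0\\ \mu(1-|z_1|^2)^{1/2}(1-|z_2|^2)^{1/2}&z_2\end{pmatrix}$$ as an operator on the Euclidean space $\mathbb C^2$, $\varphi_i(z)=\dfrac{z-z_i}{1-\bar z_i z}$ for $i=1,2$, and $$\theta(z)=\begin{pmatrix}(1-|\mu|^2)^{1/2}\varphi_2(z)&-\mu\\ \bar\mu\,\varphi_1(z)\varphi_2(z)&(1-|\mu|^2)^{1/2}\varphi_1(z)\end{pmatrix},\qquad z\in\mathbb D.$$ Then $\theta$ is inner (analytic and contractive on $\mathbb D$, with isometric radial limits at almost every point of the unit circle), $T_\mu$ is a contraction, and the characteristic function of $T_\mu$ is $\theta$ in the following sense. For a contraction $T$ let $D_T=(I-T^*T)^{1/2}$, $\mathfrak D_T=\overline{\operatorname{ran}}\,D_T$, and let $$\Theta_T(z)=\bigl[-T+zD_{T^*}(I-zT^*)^{-1}D_T\bigr]\big|_{\mathfrak D_T}:\mathfrak D_T\to\mathfrak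 D_{T^*},\qquad z\in\mathbb D,$$ be its Sz.-Nagy–Foias characteristic function. Two operator-valued functions $\Theta,\Theta'$ on $\mathbb D$ *coincide* if $\Theta'(z)=\tau'\,\Theta(z)\,\tau^{-1}$ for all $z\in\mathbb D$, with constant unitary operators $\tau,\tau'$. 1. If $|\mu|<1$, then $\Theta_{T_\mu}$ coincides with $\theta$. 2. For every $|\mu|\le 1$, $\Theta_{T_\mu}$ coincides with the purely contractive part of $\theta$. That is, there are orthogonal decompositions $\mathbb C^2=E_0\oplus E_0^\perp$ and $\mathbb C^2=F_0\oplus F_0^\perp$ of the domain and the target with respect to which $\theta(z)=\theta_0(z)\oplus U$ for all $z\in\mathbb D$, where $U:E_0^\perp\to F_0^\perp$ is a constant unitary operator, $\|\theta_0(0)e\|<\|e\|$ for all $0\ne e\in E_0$, and $\Theta_{T_\mu}$ coincides with $\theta_0$. -/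

import Mathlib

open Filter Topology MeasureTheory ComplexConjugate ContinuousLinearMap

namespace SzNagyFoias

noncomputable section

section Contraction

variable {H : Type*} [NormedAddCommGroup H] [InnerProductSpace ℂ H] [CompleteSpace H]

/-- The defect operator `D_T = (I - T* T)^{1/2}` of a contraction `T`. -/
def defectOp (T : H →L[ℂ] H) : H →L[ℂ] H := CFC.sqrt (1 - adjoint T * T)

/-- The defect space `𝔇_T`: the closure of the range of `D_T`. -/
def defectSpace (T : H →L[ℂ] H) : Submodule ℂ H :=
  (LinearMap.range (defectOp T : H →ₗ[ℂ] H)).topologicalClosure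

/-- The operator `-T + z D_{T*} (I - z T*)⁻¹ D_T` on the whole space. For `‖T‖ ≤ 1` and `|z| < 1`
the operator `I - z T*` is invertible, so that `Ring.inverse` is the genuine inverse. -/
def charOp (T : H →L[ℂ] H) (z : ℂ) : H →L[ℂ] H :=
  -T + z • (defectOp (adjoint T) * Ring.inverse (1 - z • adjoint T) * defectOp T)

theorem one_sub_adjoint_mul_self_nonneg {T : H →L[ℂ] H} (hT : ‖T‖ ≤ 1) :
    0 ≤ 1 - adjoint T * T := by
  rw [ContinuousLinearMap.nonneg_iff_isPositive, ContinuousLinearMap.isPositive_iff_complex]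
  intro x
  have h2 : ‖T x‖ ^ 2 ≤ ‖x‖ ^ 2 := by
    have := T.le_of_opNorm_le hT x
    rw [one_mul] at this
    gcongr
  have h1 : inner ℂ ((1 - adjoint T * T) x) x = (((‖x‖ ^ 2 - ‖T x‖ ^ 2 : ℝ)) : ℂ) := by
    simp [adjoint_inner_left, inner_self_eq_norm_sq_to_K]
  rw [h1]
  refine ⟨congrArg _ (Complex.ofReal_re _), ?_⟩
  exact (sub_nonneg.mpr h2).trans_eq (Complex.ofReal_re _).symm

/-- If `T A = B T` for self-adjoint `A` and `B`, then `T f(A) = f(B) T`. -/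
theorem semiconj_cfc {T A B : H →L[ℂ] H} (hA : IsSelfAdjoint A) (hB : IsSelfAdjoint B)
    (h : T * A = B * T) (f : ℝ → ℝ) (hf : Continuous f) :
    T * cfc f A = cfc f B * T := by
  let s : Set ℝ := spectrum ℝ A ∪ spectrum ℝ B
  have hs : CompactSpace s := isCompact_iff_compactSpace.mp
    ((ContinuousFunctionalCalculus.isCompact_spectrum A).union
      (ContinuousFunctionalCalculus.isCompact_spectrum B))
  have h1 : cfcHomSuperset hA (s := s) Set.subset_union_left (.restrict s <| .id ℝ) = A :=
    cfcHomSuperset_id hA _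
  have h2 : cfcHomSuperset hB (s := s) Set.subset_union_right (.restrict s <| .id ℝ) = B :=
    cfcHomSuperset_id hB _
  have key : ∀ g : C(s, ℝ),
      T * cfcHomSuperset hA Set.subset_union_left g =
        cfcHomSuperset hB Set.subset_union_right g * T := by
    intro g
    induction g using ContinuousMap.induction_on_of_compact with
    | const r =>
      have : ContinuousMap.const s r = algebraMap ℝ C(s, ℝ) r := rfl
      rw [this, AlgHomClass.commutes, AlgHomClass.commutes]
      exact (Algebra.commutes r T).symm
    | id => rw [h1, h2, h]
    | star_id =>
      rw [map_star, map_star, h1, h2, hA.star_eq, hB.star_eq, h]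
    | add f g hf hg => simp only [map_add, mul_add, add_mul, hf, hg]
    | mul f g hf hg => rw [map_mul, map_mul, ← mul_assoc, hf, mul_assoc, hg, mul_assoc]
    | frequently f hf =>
      have c1 := cfcHomSuperset_continuous hA (s := s) Set.subset_union_left
      have c2 := cfcHomSuperset_continuous hB (s := s) Set.subset_union_right
      exact (isClosed_eq (continuous_const.mul c1) (c2.mul continuous_const)).mem_of_frequently_of_tendsto
        hf tendsto_id
  have := key ⟨fun x => f x, by fun_prop⟩
  rw [cfcHomSuperset_apply, cfcHomSuperset_apply] at this
  rw [cfc_apply f A hA hf.continuousOn, cfc_apply f B hB hf.continuousOn]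
  exact this

/-- `T D_T = D_{T*} T`. -/
theorem mul_defectOp {T : H →L[ℂ] H} (hT : ‖T‖ ≤ 1) :
    T * defectOp T = defectOp (adjoint T) * T := by
  have hA := one_sub_adjoint_mul_self_nonneg hT
  have hB : 0 ≤ 1 - adjoint (adjoint T) * adjoint T :=
    one_sub_adjoint_mul_self_nonneg (by simpa using hT)
  rw [defectOp, defectOp, CFC.sqrt_eq_real_sqrt _ hA, CFC.sqrt_eq_real_sqrt _ hB,
    cfcₙ_eq_cfc, cfcₙ_eq_cfc]
  refine semiconj_cfc (.of_nonneg hA) (.of_nonneg hB) ?_ _ Real.continuous_sqrt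
  simp only [adjoint_adjoint]
  noncomm_ring

theorem charOp_mem_defectSpace {T : H →L[ℂ] H} (hT : ‖T‖ ≤ 1) (z : ℂ) (x : defectSpace T) :
    charOp T z x ∈ defectSpace (adjoint T) := by
  have h1 : ∀ y ∈ defectSpace T, T y ∈ defectSpace (adjoint T) := by
    intro y hy
    refine map_mem_closure T.continuous hy ?_
    rintro _ ⟨w, rfl⟩
    exact ⟨T w, (DFunLike.congr_fun (mul_defectOp hT) w).symm⟩
  refine add_mem (neg_mem (h1 _ x.2)) (Submodule.smul_mem _ _ ?_)
  exact subset_closure ⟨_, rfl⟩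

/-- The Sz.-Nagy–Foias characteristic function of a contraction `T`,
`Θ_T(z) = [-T + z D_{T*} (I - z T*)⁻¹ D_T]|_{𝔇_T} : 𝔇_T → 𝔇_{T*}`, for `|z| < 1`. -/
def charFun (T : H →L[ℂ] H) (hT : ‖T‖ ≤ 1) (z : ℂ) :
    defectSpace T →L[ℂ] defectSpace (adjoint T) :=
  ((charOp T z).comp (defectSpace T).subtypeL).codRestrict (defectSpace (adjoint T))
    (charOp_mem_defectSpace hT z)

end Contraction

section OperatorFunctions

variable {E F E' F' : Type*}
  [NormedAddCommGroup E] [InnerProductSpace ℂ E] [NormedAddCommGroup F] [InnerProductSpace ℂ F]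
  [NormedAddCommGroup E'] [InnerProductSpace ℂ E'] [NormedAddCommGroup F'] [InnerProductSpace ℂ F']

/-- Two operator-valued functions on the unit disc coincide if they agree up to constant unitary
operators on the two sides: `Θ'(z) = τ' Θ(z) τ⁻¹`. -/
def Coincide (Θ : ℂ → E →L[ℂ] F) (Θ' : ℂ → E' →L[ℂ] F') : Prop :=
  ∃ (τ : E ≃ₗᵢ[ℂ] E') (τ' : F ≃ₗᵢ[ℂ] F'),
    ∀ z : ℂ, ‖z‖ < 1 → ∀ e : E, Θ' z (τ e) = τ' (Θ z e)

/-- An inner function: analytic and contractive on the open unit disc, with isometric strong radial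
limits at almost every point of the unit circle. -/
structure IsInner (Θ : ℂ → E →L[ℂ] F) : Prop where
  analytic : DifferentiableOn ℂ Θ (Metric.ball 0 1)
  contractive : ∀ z : ℂ, ‖z‖ < 1 → ‖Θ z‖ ≤ 1
  boundary : ∀ᵐ t : ℝ, ∃ V : E →ₗᵢ[ℂ] F, ∀ e : E,
    Tendsto (fun r : ℝ => Θ ((r : ℂ) * Complex.exp (t * Complex.I)) e) (𝓝[<] 1) (𝓝 (V e))

/-- `Θ₀ : 𝔻 → B(E₀, F₀)` is the purely contractive part of `Θ : 𝔻 → B(E, F)`: with respect to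
`E = E₀ ⊕ E₀ᗮ` and `F = F₀ ⊕ F₀ᗮ`, the function `Θ` is the direct sum of `Θ₀`, which is purely
contractive (`‖Θ₀(0) e‖ < ‖e‖` for `e ≠ 0`), and of a constant unitary operator `U`. -/
structure IsPurePart (Θ : ℂ → E →L[ℂ] F) (E₀ : Submodule ℂ E) (F₀ : Submodule ℂ F)
    (Θ₀ : ℂ → E₀ →L[ℂ] F₀) : Prop where
  isClosed_dom : IsClosed (E₀ : Set E)
  isClosed_cod : IsClosed (F₀ : Set F)
  restrict : ∀ z : ℂ, ‖z‖ < 1 → ∀ e : E₀, Θ z (e : E) = (Θ₀ z e : F)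
  pure : ∀ e : E₀, e ≠ 0 → ‖Θ₀ 0 e‖ < ‖e‖
  unitary : ∃ U : E₀ᗮ ≃ₗᵢ[ℂ] F₀ᗮ, ∀ z : ℂ, ‖z‖ < 1 → ∀ e : E₀ᗮ, Θ z (e : E) = (U e : F)

end OperatorFunctions

/-- The operator on the Euclidean space `ℂ²` given by a `2 × 2` matrix. -/
abbrev toOp (A : Matrix (Fin 2) (Fin 2) ℂ) :
    EuclideanSpace ℂ (Fin 2) →L[ℂ] EuclideanSpace ℂ (Fin 2) :=
  Matrix.toEuclideanCLM (n := Fin 2) (𝕜 := ℂ) A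

/-- The matrix `T_μ`. -/
def matT (z₁ z₂ μ : ℂ) : Matrix (Fin 2) (Fin 2) ℂ :=
  !![z₁, 0;
     μ * (Real.sqrt (1 - ‖z₁‖ ^ 2) : ℂ) * (Real.sqrt (1 - ‖z₂‖ ^ 2) : ℂ), z₂]

/-- The Blaschke factor `φ_a(z) = (z - a) / (1 - conj a * z)`. -/
def blaschke (a z : ℂ) : ℂ := (z - a) / (1 - conj a * z)

/-- The matrix-valued function `θ`. -/
def matTheta (z₁ z₂ μ z : ℂ) : Matrix (Fin 2) (Fin 2) ℂ :=
  !![(Real.sqrt (1 - ‖μ‖ ^ 2) : ℂ) * blaschke z₂ z, -μ;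
     conj μ * blaschke z₁ z * blaschke z₂ z, (Real.sqrt (1 - ‖μ‖ ^ 2) : ℂ) * blaschke z₁ z]

end

end SzNagyFoias

namespace SzNagyFoias

noncomputable section

section OperatorFunctions

variable {E F E' F' : Type*}
  [NormedAddCommGroup E] [InnerProductSpace ℂ E] [NormedAddCommGroup F] [InnerProductSpace ℂ F]
  [NormedAddCommGroup E'] [InnerProductSpace ℂ E'] [NormedAddCommGroup F'] [InnerProductSpace ℂ F']

/-! With m = (1 - |μ|²)^{1/2} and s_i = (1 - |z_i|²)^{1/2}, θ = diag(1, φ₁) R diag(φ₂, 1), where R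
has rows (m, -μ), (conj μ, m) and is unitary. Blaschke factors are bounded by 1 on the disc and
unimodular on the circle, so θ is inner.

Each φ_i is the transfer function of the unitary colligation with rows (conj z_i, s_i), (s_i, -z_i).
Cascading these two through R gives a unitary colligation with state operator T_μ*, feedthrough θ(0)
and transfer function θ (`isUnitaryColligation_matT`, `transferFun_matT`).

The rest is general. In a unitary colligation B B* = D_T² and C* C = D_{T*}², so B* and C are D_T
and D_{T*} up to unitaries between closures of ranges. These unitaries carry Θ_T to the transfer
function restricted to those closures (`coincide_charFun`). On the complement, ker B, the transfer
function is the constant D, which is unitary onto ker C* (`isPurePart`). If |μ| < 1, then B and C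
are invertible and nothing is split off. -/

theorem Coincide.congr_right {Θ : ℂ → E →L[ℂ] F} {Θ₁ Θ₂ : ℂ → E' →L[ℂ] F'} (h : Coincide Θ Θ₁)
    (h12 : ∀ z : ℂ, ‖z‖ < 1 → Θ₁ z = Θ₂ z) : Coincide Θ Θ₂ := by
  obtain ⟨τ, τ', h1⟩ := h
  exact ⟨τ, τ', fun z hz => h12 z hz ▸ h1 z hz⟩

theorem IsPurePart.congr {Θ₁ Θ₂ : ℂ → E →L[ℂ] F} {E₀ : Submodule ℂ E} {F₀ : Submodule ℂ F}
    {Θ₀ : ℂ → E₀ →L[ℂ] F₀} (h : IsPurePart Θ₁ E₀ F₀ Θ₀)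
    (h12 : ∀ z : ℂ, ‖z‖ < 1 → Θ₁ z = Θ₂ z) : IsPurePart Θ₂ E₀ F₀ Θ₀ where
  isClosed_dom := h.isClosed_dom
  isClosed_cod := h.isClosed_cod
  restrict z hz := h12 z hz ▸ h.restrict z hz
  pure := h.pure
  unitary := by
    obtain ⟨U, hU⟩ := h.unitary
    exact ⟨U, fun z hz => h12 z hz ▸ hU z hz⟩

end OperatorFunctions

/-! ### Unitary colligations and their transfer functions. -/

section Colligation

variable {H E F : Type*} [NormedAddCommGroup H] [InnerProductSpace ℂ H]
  [NormedAddCommGroup E] [InnerProductSpace ℂ E] [NormedAddCommGroup F] [InnerProductSpace ℂ F]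

/-- The closure of the range of a bounded operator. -/
def closedRange (A : H →L[ℂ] E) : Submodule ℂ E :=
  (LinearMap.range (A : H →ₗ[ℂ] E)).topologicalClosure

theorem apply_mem_closedRange (A : H →L[ℂ] E) (x : H) : A x ∈ closedRange A :=
  subset_closure ⟨x, rfl⟩

theorem isClosed_closedRange (A : H →L[ℂ] E) : IsClosed (closedRange A : Set E) :=
  Submodule.isClosed_topologicalClosure _

/-- A bounded operator, with values in the closure of its range. -/
def toClosedRange (A : H →L[ℂ] E) : H →L[ℂ] closedRange A :=
  A.codRestrict (closedRange A) (apply_mem_closedRange A)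

@[simp]
theorem coe_toClosedRange (A : H →L[ℂ] E) (x : H) : (toClosedRange A x : E) = A x := rfl

theorem denseRange_toClosedRange (A : H →L[ℂ] E) : DenseRange (toClosedRange A) := by
  intro y
  rw [closure_subtype]
  refine closure_mono ?_ y.2
  rintro _ ⟨x, rfl⟩
  exact ⟨toClosedRange A x, ⟨x, rfl⟩, rfl⟩

/-- Operators `A`, `A'` with `‖A x‖ = ‖A' x‖` differ by a unitary between the closures of their
ranges. -/
theorem exists_isometryEquiv_closedRange [CompleteSpace E] [CompleteSpace F]
    {A : H →L[ℂ] E} {A' : H →L[ℂ] F} (h : ∀ x, ‖A' x‖ = ‖A x‖) :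
    ∃ τ : closedRange A ≃ₗᵢ[ℂ] closedRange A', ∀ x, τ (toClosedRange A x) = toClosedRange A' x := by
  have : CompleteSpace (closedRange A) := (isClosed_closedRange A).completeSpace_coe
  have : CompleteSpace (closedRange A') := (isClosed_closedRange A').completeSpace_coe
  exact ⟨(LinearEquiv.refl ℂ H).extendOfIsometry (toClosedRange A : H →ₗ[ℂ] closedRange A)
      (toClosedRange A' : H →ₗ[ℂ] closedRange A') (denseRange_toClosedRange A)
      (denseRange_toClosedRange A') h,
    LinearEquiv.extendOfIsometry_eq _ _ _ _ _ _⟩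

variable [CompleteSpace H] [CompleteSpace E] [CompleteSpace F]

theorem mem_orthogonal_closedRange {A : H →L[ℂ] E} {e : E} :
    e ∈ (closedRange A)ᗮ ↔ adjoint A e = 0 := by
  rw [closedRange, Submodule.orthogonal_closure, ContinuousLinearMap.orthogonal_range]
  rfl

theorem norm_apply_eq_norm_apply_of_adjoint_comp_eq {A : H →L[ℂ] E} {A' : H →L[ℂ] F}
    (h : adjoint A ∘L A = adjoint A' ∘L A') (x : H) : ‖A x‖ = ‖A' x‖ := by
  rw [apply_norm_eq_sqrt_inner_adjoint_left, apply_norm_eq_sqrt_inner_adjoint_left, h]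

theorem norm_sq_add_norm_sq_of_adjoint_comp_add_eq_one {A : H →L[ℂ] E} {A' : H →L[ℂ] F}
    (h : adjoint A ∘L A + adjoint A' ∘L A' = 1) (x : H) :
    ‖A x‖ ^ 2 + ‖A' x‖ ^ 2 = ‖x‖ ^ 2 := by
  rw [apply_norm_sq_eq_inner_adjoint_left, apply_norm_sq_eq_inner_adjoint_left, ← map_add,
    ← inner_add_left, ← add_apply, h, ← inner_self_eq_norm_sq (𝕜 := ℂ)]
  rfl

theorem defectOp_mul_self {T : H →L[ℂ] H} (hT : ‖T‖ ≤ 1) :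
    defectOp T * defectOp T = 1 - adjoint T * T :=
  CFC.sqrt_mul_sqrt_self _ (one_sub_adjoint_mul_self_nonneg hT)

theorem adjoint_defectOp (T : H →L[ℂ] H) : adjoint (defectOp T) = defectOp T :=
  (IsSelfAdjoint.of_nonneg (CFC.sqrt_nonneg _)).star_eq

/-- The operator matrix with rows `(T*, B)` and `(C, D)` is unitary from `H ⊕ E` to `H ⊕ F`. -/
structure IsUnitaryColligation (T : H →L[ℂ] H) (B : E →L[ℂ] H) (C : H →L[ℂ] F) (D : E →L[ℂ] F) :
    Prop where
  -- With U the operator matrix, `state_left`, `input`, `mixed_left` are the blocks of U*U = 1, the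
  -- others those of UU* = 1; the missing off-diagonal blocks are adjoints of the mixed ones.
  state_left : T ∘L adjoint T + adjoint C ∘L C = 1
  state_right : adjoint T ∘L T + B ∘L adjoint B = 1
  input : adjoint B ∘L B + adjoint D ∘L D = 1
  output : C ∘L adjoint C + D ∘L adjoint D = 1
  mixed_left : T ∘L B + adjoint C ∘L D = 0
  mixed_right : C ∘L T + D ∘L adjoint B = 0

/-- The transfer function `D + z C (I - z T*)⁻¹ B`. -/
def transferFun (T : H →L[ℂ] H) (B : E →L[ℂ] H) (C : H →L[ℂ] F) (D : E →L[ℂ] F)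
    (z : ℂ) : E →L[ℂ] F :=
  D + z • (C ∘L Ring.inverse (1 - z • adjoint T) ∘L B)

namespace IsUnitaryColligation

variable {T : H →L[ℂ] H} {B : E →L[ℂ] H} {C : H →L[ℂ] F} {D : E →L[ℂ] F}

theorem norm_le_one (h : IsUnitaryColligation T B C D) : ‖T‖ ≤ 1 := by
  refine T.opNorm_le_bound zero_le_one fun x => ?_
  have h1 := norm_sq_add_norm_sq_of_adjoint_comp_add_eq_one (A := T) (A' := adjoint B)
    (by rw [adjoint_adjoint]; exact h.state_right) x
  rw [one_mul]
  exact (sq_le_sq₀ (norm_nonneg _) (norm_nonneg _)).mp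
    ((le_add_of_nonneg_right (sq_nonneg _)).trans_eq h1)

/-- Since D B* = -C T and B B* = D_T², the factor C comes out on the left. What remains inside is
the expression that Θ_T(z) D_T yields once D_{T*} is taken out. -/
theorem transferFun_adjoint_apply (h : IsUnitaryColligation T B C D) (z : ℂ) (x : H) :
    transferFun T B C D z (adjoint B x) =
      C (-T x + z • Ring.inverse (1 - z • adjoint T) (defectOp T (defectOp T x))) := by
  have h1 : D (adjoint B x) = -C (T x) :=
    eq_neg_of_add_eq_zero_right (DFunLike.congr_fun h.mixed_right x)
  have h2 : B (adjoint B x) = defectOp T (defectOp T x) := by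
    have h3 : adjoint T (T x) + B (adjoint B x) = x := DFunLike.congr_fun h.state_right x
    have h4 : defectOp T (defectOp T x) = x - adjoint T (T x) :=
      DFunLike.congr_fun (defectOp_mul_self h.norm_le_one) x
    rw [h4, eq_sub_of_add_eq' h3]
  simp [transferFun, h1, h2]

theorem transferFun_mem (h : IsUnitaryColligation T B C D) (z : ℂ)
    (e : closedRange (adjoint B)) : transferFun T B C D z e ∈ closedRange C := by
  refine (denseRange_toClosedRange (adjoint B)).induction_on
    (p := fun e => transferFun T B C D z e ∈ closedRange C) e
    ((isClosed_closedRange C).preimage (by fun_prop)) fun x => ?_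
  rw [coe_toClosedRange, h.transferFun_adjoint_apply]
  exact apply_mem_closedRange C _

/-- The restriction of the transfer function to the closures of the ranges of `B*` and `C`. -/
def pureTransferFun (h : IsUnitaryColligation T B C D) (z : ℂ) :
    closedRange (adjoint B) →L[ℂ] closedRange C :=
  ((transferFun T B C D z).comp (closedRange (adjoint B)).subtypeL).codRestrict (closedRange C)
    (h.transferFun_mem z)

@[simp]
theorem coe_pureTransferFun (h : IsUnitaryColligation T B C D) (z : ℂ)
    (e : closedRange (adjoint B)) : (h.pureTransferFun z e : F) = transferFun T B C D z e := rfl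

/-- The characteristic function of `T` coincides with the restricted transfer function. -/
theorem coincide_charFun (h : IsUnitaryColligation T B C D) (hT : ‖T‖ ≤ 1) :
    Coincide (charFun T hT) h.pureTransferFun := by
  have hT' : ‖adjoint T‖ ≤ 1 := by simpa using hT
  -- The defect spaces are by definition the closed ranges of the defect operators; B B* = 1 - T*T
  -- gives ‖D_T x‖ = ‖B* x‖.
  obtain ⟨τ, hτ⟩ := exists_isometryEquiv_closedRange (A := defectOp T) (A' := adjoint B) <|
    norm_apply_eq_norm_apply_of_adjoint_comp_eq <| by
      rw [adjoint_adjoint, adjoint_defectOp, ← mul_def, defectOp_mul_self hT, mul_def,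
        ← h.state_right, add_sub_cancel_left]
  obtain ⟨τ', hτ'⟩ := exists_isometryEquiv_closedRange (A := defectOp (adjoint T)) (A' := C) <|
    norm_apply_eq_norm_apply_of_adjoint_comp_eq <| by
      rw [adjoint_defectOp, ← mul_def (defectOp _), defectOp_mul_self hT', mul_def,
        ← h.state_left, adjoint_adjoint, add_sub_cancel_left]
  refine ⟨τ, τ', fun z _ e => ?_⟩
  refine (denseRange_toClosedRange (defectOp T)).induction_on
    (p := fun e => h.pureTransferFun z (τ e) = τ' (charFun T hT z e)) e
    (isClosed_eq (by fun_prop) (τ'.continuous.comp (charFun T hT z).continuous)) fun x => ?_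
  -- The intertwining T D_T = D_{T*} T lets D_{T*} factor out on the left.
  have h1 : charFun T hT z (toClosedRange (defectOp T) x) =
      toClosedRange (defectOp (adjoint T))
        (-T x + z • Ring.inverse (1 - z • adjoint T) (defectOp T (defectOp T x))) := by
    refine Subtype.ext ?_
    have h2 : T (defectOp T x) = defectOp (adjoint T) (T x) := DFunLike.congr_fun (mul_defectOp hT) x
    change -T (defectOp T x) + z • defectOp (adjoint T)
      (Ring.inverse (1 - z • adjoint T) (defectOp T (defectOp T x))) = _
    simp [h2]
  rw [h1, hτ', hτ]
  refine Subtype.ext ?_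
  rw [coe_pureTransferFun, coe_toClosedRange, coe_toClosedRange, h.transferFun_adjoint_apply]

/-- The restricted transfer function is the purely contractive part of the transfer function. -/
theorem isPurePart (h : IsUnitaryColligation T B C D) :
    IsPurePart (transferFun T B C D) (closedRange (adjoint B)) (closedRange C)
      h.pureTransferFun where
  isClosed_dom := isClosed_closedRange _
  isClosed_cod := isClosed_closedRange _
  restrict _ _ _ := rfl
  pure e he := by
    have h1 := norm_sq_add_norm_sq_of_adjoint_comp_add_eq_one h.input (e : E)
    -- The kernel of B is orthogonal to the range of B*, so the defect ‖e‖² - ‖D e‖² = ‖B e‖² is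
    -- positive.
    have h2 : B e ≠ 0 := fun h0 => he <| by
      have h3 : (e : E) ∈ (closedRange (adjoint B))ᗮ :=
        mem_orthogonal_closedRange.mpr (by rwa [adjoint_adjoint])
      exact Subtype.ext (inner_self_eq_zero.mp (h3 e e.2))
    have h4 : ‖h.pureTransferFun 0 e‖ = ‖D e‖ := by
      change ‖transferFun T B C D 0 e‖ = _
      simp [transferFun]
    rw [h4]
    change ‖D e‖ < ‖(e : E)‖
    refine (sq_lt_sq₀ (norm_nonneg _) (norm_nonneg _)).mp ?_
    rw [← h1]
    exact lt_add_of_pos_left _ (pow_pos (norm_pos_iff.mpr h2) 2)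
  unitary := by
    have hE : ∀ {e : E}, e ∈ (closedRange (adjoint B))ᗮ ↔ B e = 0 := by
      intro e
      rw [mem_orthogonal_closedRange, adjoint_adjoint]
    have hF : ∀ {f : F}, f ∈ (closedRange C)ᗮ ↔ adjoint C f = 0 := mem_orthogonal_closedRange
    -- The mixed relations make D map ker B into ker C* and D* map back; the `input` and `output`
    -- relations make them mutually inverse there.
    have hD : ∀ e ∈ (closedRange (adjoint B))ᗮ, D e ∈ (closedRange C)ᗮ := fun e he => by
      have h1 : T (B e) + adjoint C (D e) = 0 := DFunLike.congr_fun h.mixed_left e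
      rwa [hE.mp he, map_zero, zero_add, ← hF] at h1
    have hD' : ∀ f ∈ (closedRange C)ᗮ, adjoint D f ∈ (closedRange (adjoint B))ᗮ := fun f hf => by
      have h1 : adjoint T (adjoint C f) + B (adjoint D f) = 0 := by
        have h2 := congrArg adjoint h.mixed_right
        rw [map_add, adjoint_comp, adjoint_comp, adjoint_adjoint, map_zero] at h2
        exact DFunLike.congr_fun h2 f
      rwa [hF.mp hf, map_zero, zero_add, ← hE] at h1
    have hinv : ∀ e ∈ (closedRange (adjoint B))ᗮ, adjoint D (D e) = e := fun e he => by
      have h1 : adjoint B (B e) + adjoint D (D e) = e := DFunLike.congr_fun h.input e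
      rwa [hE.mp he, map_zero, zero_add] at h1
    have hinv' : ∀ f ∈ (closedRange C)ᗮ, D (adjoint D f) = f := fun f hf => by
      have h1 : C (adjoint C f) + D (adjoint D f) = f := DFunLike.congr_fun h.output f
      rwa [hF.mp hf, map_zero, zero_add] at h1
    refine ⟨⟨LinearEquiv.ofLinearMap ((D : E →ₗ[ℂ] F).restrict hD)
      ((adjoint D : F →ₗ[ℂ] E).restrict hD') (LinearMap.ext fun f => Subtype.ext (hinv' f f.2))
      (LinearMap.ext fun e => Subtype.ext (hinv e e.2)), fun e => ?_⟩, fun z _ e => ?_⟩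
    · have h1 := norm_sq_add_norm_sq_of_adjoint_comp_add_eq_one h.input (e : E)
      rw [hE.mp e.2, norm_zero, zero_pow two_ne_zero, zero_add] at h1
      exact (sq_eq_sq₀ (norm_nonneg _) (norm_nonneg _)).mp h1
    · change D e + z • C (Ring.inverse (1 - z • adjoint T) (B e)) = D e
      rw [hE.mp e.2, map_zero, map_zero, smul_zero, add_zero]

/-- If `B*` and `C` have dense range, the characteristic function coincides with the transfer
function itself. -/
theorem coincide_charFun_transferFun (h : IsUnitaryColligation T B C D) (hT : ‖T‖ ≤ 1)
    (hB : closedRange (adjoint B) = ⊤) (hC : closedRange C = ⊤) :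
    Coincide (charFun T hT) (transferFun T B C D) := by
  obtain ⟨τ, τ', h1⟩ := h.coincide_charFun hT
  exact ⟨τ.trans (LinearIsometryEquiv.ofTop _ _ hB), τ'.trans (LinearIsometryEquiv.ofTop _ _ hC),
    fun z hz e => congrArg Subtype.val (h1 z hz e)⟩

end IsUnitaryColligation

end Colligation

/-! ### Transfer to 2 × 2 matrices. -/

section Matrices

theorem star_fin_two (a b c d : ℂ) : star !![a, b; c, d] = !![conj a, conj c; conj b, conj d] := by
  ext i j
  fin_cases i <;> fin_cases j <;> rfl

theorem adjoint_toOp (A : Matrix (Fin 2) (Fin 2) ℂ) : adjoint (toOp A) = toOp (star A) :=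
  (map_star (Matrix.toEuclideanCLM (n := Fin 2) (𝕜 := ℂ)) A).symm

theorem toOp_comp_toOp (A B : Matrix (Fin 2) (Fin 2) ℂ) : toOp A ∘L toOp B = toOp (A * B) :=
  (map_mul (Matrix.toEuclideanCLM (n := Fin 2) (𝕜 := ℂ)) A B).symm

theorem ringInverse_toOp {A N : Matrix (Fin 2) (Fin 2) ℂ} (h : A * N = 1) :
    Ring.inverse (toOp A) = toOp N := by
  have h' : N * A = 1 := mul_eq_one_comm.mp h
  exact Ring.inverse_unit ⟨toOp A, toOp N, by rw [← map_mul, h, map_one],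
    by rw [← map_mul, h', map_one]⟩

theorem isUnitaryColligation_toOp {T B C D : Matrix (Fin 2) (Fin 2) ℂ}
    (h1 : T * star T + star C * C = 1) (h2 : star T * T + B * star B = 1)
    (h3 : star B * B + star D * D = 1) (h4 : C * star C + D * star D = 1)
    (h5 : T * B + star C * D = 0) (h6 : C * T + D * star B = 0) :
    IsUnitaryColligation (toOp T) (toOp B) (toOp C) (toOp D) := by
  constructor <;> simp only [adjoint_toOp, toOp_comp_toOp, ← map_add, h1, h2, h3, h4, h5, h6,
    map_one, map_zero]

theorem transferFun_toOp {T B C D N : Matrix (Fin 2) (Fin 2) ℂ} {z : ℂ}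
    (h : (1 - z • star T) * N = 1) :
    transferFun (toOp T) (toOp B) (toOp C) (toOp D) z = toOp (D + z • (C * (N * B))) := by
  have h1 : 1 - z • adjoint (toOp T) = toOp (1 - z • star T) := by
    simp only [adjoint_toOp, toOp, map_sub, map_one, map_smul]
  rw [transferFun, h1, ringInverse_toOp h, toOp_comp_toOp, toOp_comp_toOp, toOp, toOp, toOp, map_add,
    map_smul]

theorem closedRange_toOp_eq_top {A : Matrix (Fin 2) (Fin 2) ℂ} (hA : A.det ≠ 0) :
    closedRange (toOp A) = ⊤ := by
  refine eq_top_iff.mpr fun x _ => ?_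
  have h1 : toOp A (toOp A⁻¹ x) = x := by
    have h2 := toOp_comp_toOp A A⁻¹
    rw [Matrix.mul_nonsing_inv A hA.isUnit, toOp, toOp, toOp, map_one] at h2
    exact DFunLike.congr_fun h2 x
  exact h1 ▸ apply_mem_closedRange (toOp A) (toOp A⁻¹ x)

theorem norm_sq_toOp_apply (A : Matrix (Fin 2) (Fin 2) ℂ) (e : EuclideanSpace ℂ (Fin 2)) :
    ‖toOp A e‖ ^ 2 = ‖A 0 0 * e 0 + A 0 1 * e 1‖ ^ 2 + ‖A 1 0 * e 0 + A 1 1 * e 1‖ ^ 2 := by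
  rw [EuclideanSpace.norm_sq_eq, Fin.sum_univ_two, Matrix.ofLp_toEuclideanCLM]
  simp [Matrix.mulVec, dotProduct, Fin.sum_univ_two]

theorem continuous_toOp : Continuous toOp :=
  LinearMap.continuous_of_finiteDimensional
    (Matrix.toEuclideanCLM (n := Fin 2) (𝕜 := ℂ)).toAlgEquiv.toLinearMap

theorem differentiableOn_toOp {M : ℂ → Matrix (Fin 2) (Fin 2) ℂ} {s : Set ℂ}
    (hM : ∀ i j, DifferentiableOn ℂ (fun z => M z i j) s) :
    DifferentiableOn ℂ (fun z => toOp (M z)) s := by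
  have h1 : ∀ z, toOp (M z) = ∑ i, ∑ j, M z i j • toOp (Matrix.single i j 1) := fun z => by
    conv_lhs => rw [Matrix.matrix_eq_sum_single (M z)]
    simp only [map_sum, ← map_smul, Matrix.smul_single, smul_eq_mul, mul_one]
  simp only [h1]
  exact DifferentiableOn.fun_sum fun i _ => DifferentiableOn.fun_sum fun j _ =>
    (hM i j).smul_const _

end Matrices

/-! ### Blaschke factors and innerness of θ. -/

theorem sq_sqrt_one_sub_norm_sq {w : ℂ} (hw : ‖w‖ ≤ 1) :
    ((Real.sqrt (1 - ‖w‖ ^ 2) : ℝ) : ℂ) ^ 2 = 1 - w * conj w := by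
  have h1 : ‖w‖ ^ 2 ≤ 1 := pow_le_one₀ (norm_nonneg _) hw
  rw [← Complex.ofReal_pow, Real.sq_sqrt (sub_nonneg.mpr h1), Complex.mul_conj']
  push_cast
  rfl

theorem one_sub_conj_mul_ne_zero {a z : ℂ} (ha : ‖a‖ < 1) (hz : ‖z‖ ≤ 1) :
    1 - conj a * z ≠ 0 := by
  intro h
  have h1 : ‖conj a * z‖ < 1 := by
    rw [norm_mul, RCLike.norm_conj]
    exact (mul_le_of_le_one_right (norm_nonneg _) hz).trans_lt ha
  rw [← sub_eq_zero.mp h, norm_one] at h1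
  exact lt_irrefl _ h1

theorem norm_sub_sq_add (a z : ℂ) :
    ‖z - a‖ ^ 2 + (1 - ‖a‖ ^ 2) * (1 - ‖z‖ ^ 2) = ‖1 - conj a * z‖ ^ 2 := by
  simp only [← Complex.normSq_eq_norm_sq, Complex.normSq_apply]
  simp
  ring

theorem norm_blaschke_le_one {a z : ℂ} (ha : ‖a‖ < 1) (hz : ‖z‖ ≤ 1) : ‖blaschke a z‖ ≤ 1 := by
  rw [blaschke, norm_div]
  refine div_le_one_of_le₀ ((sq_le_sq₀ (norm_nonneg _) (norm_nonneg _)).mp ?_) (norm_nonneg _)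
  rw [← norm_sub_sq_add]
  exact le_add_of_nonneg_right (mul_nonneg (sub_nonneg.mpr (pow_le_one₀ (norm_nonneg _) ha.le))
    (sub_nonneg.mpr (pow_le_one₀ (norm_nonneg _) hz)))

theorem norm_blaschke_eq_one {a z : ℂ} (ha : ‖a‖ < 1) (hz : ‖z‖ = 1) : ‖blaschke a z‖ = 1 := by
  rw [blaschke, norm_div, div_eq_one_iff_eq (norm_ne_zero_iff.mpr
    (one_sub_conj_mul_ne_zero ha hz.le))]
  refine (sq_eq_sq₀ (norm_nonneg _) (norm_nonneg _)).mp ?_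
  rw [← norm_sub_sq_add, hz]
  ring

theorem differentiableAt_blaschke {a z : ℂ} (ha : ‖a‖ < 1) (hz : ‖z‖ ≤ 1) :
    DifferentiableAt ℂ (blaschke a) z := by
  unfold blaschke
  exact DifferentiableAt.fun_div (by fun_prop) (by fun_prop) (one_sub_conj_mul_ne_zero ha hz)

theorem differentiableAt_matTheta (z₁ z₂ μ : ℂ) (hz₁ : ‖z₁‖ < 1) (hz₂ : ‖z₂‖ < 1) {z : ℂ}
    (hz : ‖z‖ ≤ 1) (i j : Fin 2) : DifferentiableAt ℂ (fun z => matTheta z₁ z₂ μ z i j) z := by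
  have h1 := differentiableAt_blaschke hz₁ hz
  have h2 := differentiableAt_blaschke hz₂ hz
  fin_cases i <;> fin_cases j <;> simp [matTheta] <;> fun_prop

theorem norm_sq_add_norm_sq_rotation {μ : ℂ} (hμ : ‖μ‖ ≤ 1) (u v : ℂ) :
    ‖(Real.sqrt (1 - ‖μ‖ ^ 2) : ℂ) * u - μ * v‖ ^ 2 +
      ‖conj μ * u + (Real.sqrt (1 - ‖μ‖ ^ 2) : ℂ) * v‖ ^ 2 = ‖u‖ ^ 2 + ‖v‖ ^ 2 := by
  have h1 := sq_sqrt_one_sub_norm_sq hμ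
  apply Complex.ofReal_injective
  push_cast
  simp only [← Complex.mul_conj', map_sub, map_add, map_mul, Complex.conj_conj, Complex.conj_ofReal]
  linear_combination (u * conj u + v * conj v) * h1

/-- Read off from θ = diag(1, φ₁) R diag(φ₂, 1), with the norm of R left to
`norm_sq_add_norm_sq_rotation`. -/
theorem norm_sq_toOp_matTheta_apply (z₁ z₂ μ z : ℂ) (e : EuclideanSpace ℂ (Fin 2)) :
    ‖toOp (matTheta z₁ z₂ μ z) e‖ ^ 2 =
      ‖(Real.sqrt (1 - ‖μ‖ ^ 2) : ℂ) * (blaschke z₂ z * e 0) - μ * e 1‖ ^ 2 +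
      ‖blaschke z₁ z‖ ^ 2 *
        ‖conj μ * (blaschke z₂ z * e 0) + (Real.sqrt (1 - ‖μ‖ ^ 2) : ℂ) * e 1‖ ^ 2 := by
  rw [norm_sq_toOp_apply, ← mul_pow, ← norm_mul]
  simp only [matTheta, Matrix.of_apply, Matrix.cons_val', Matrix.cons_val_zero,
    Matrix.cons_val_one, Matrix.cons_val_fin_one]
  congr 3 <;> ring

theorem isInner_matTheta (z₁ z₂ μ : ℂ) (hz₁ : ‖z₁‖ < 1) (hz₂ : ‖z₂‖ < 1) (hμ : ‖μ‖ ≤ 1) :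
    IsInner (fun z => toOp (matTheta z₁ z₂ μ z)) where
  analytic := differentiableOn_toOp fun i j z hz =>
    (differentiableAt_matTheta z₁ z₂ μ hz₁ hz₂ (mem_ball_zero_iff.mp hz).le i
      j).differentiableWithinAt
  contractive z hz := by
    refine ContinuousLinearMap.opNorm_le_bound _ zero_le_one fun e => ?_
    rw [one_mul]
    refine (sq_le_sq₀ (norm_nonneg _) (norm_nonneg _)).mp ?_
    have h1 := pow_le_one₀ (n := 2) (norm_nonneg _) (norm_blaschke_le_one hz₁ hz.le)
    have h2 := pow_le_one₀ (n := 2) (norm_nonneg _) (norm_blaschke_le_one hz₂ hz.le)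
    rw [norm_sq_toOp_matTheta_apply, EuclideanSpace.norm_sq_eq, Fin.sum_univ_two]
    calc _ ≤ _ := add_le_add_right (mul_le_of_le_one_left (sq_nonneg _) h1) _
      _ = _ := norm_sq_add_norm_sq_rotation hμ _ _
      _ ≤ _ := by
        rw [norm_mul, mul_pow]
        exact add_le_add_left (mul_le_of_le_one_left (sq_nonneg _) h2) _
  -- The poles lie outside the closed disc, so θ is continuous up to the circle and the radial limit
  -- exists at every point.
  boundary := .of_forall fun t => by
    set w : ℂ := Complex.exp (t * Complex.I)
    have hw : ‖w‖ = 1 := Complex.norm_exp_ofReal_mul_I t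
    refine ⟨⟨(toOp (matTheta z₁ z₂ μ w) : _ →ₗ[ℂ] _), fun e => ?_⟩, fun e => ?_⟩
    · refine (sq_eq_sq₀ (norm_nonneg _) (norm_nonneg _)).mp
        ((norm_sq_toOp_matTheta_apply z₁ z₂ μ w e).trans ?_)
      rw [norm_blaschke_eq_one hz₁ hw, one_pow, one_mul, norm_sq_add_norm_sq_rotation hμ, norm_mul,
        norm_blaschke_eq_one hz₂ hw, one_mul, EuclideanSpace.norm_sq_eq, Fin.sum_univ_two]
    · have h1 : ContinuousAt (matTheta z₁ z₂ μ) w :=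
        continuousAt_pi.mpr fun i => continuousAt_pi.mpr fun j =>
          (differentiableAt_matTheta z₁ z₂ μ hz₁ hz₂ hw.le i j).continuousAt
      have h2 : Tendsto (fun r : ℝ => (r : ℂ) * w) (𝓝[<] 1) (𝓝 w) := by
        have h3 : Continuous fun r : ℝ => (r : ℂ) * w := by fun_prop
        simpa using (h3.tendsto 1).mono_left nhdsWithin_le_nhds
      exact ((ContinuousLinearMap.apply ℂ _ e).continuous.tendsto _).comp
        ((continuous_toOp.tendsto _).comp (h1.tendsto.comp h2))

/-! ### The colligation of T_μ. -/

/-- The input operator of a unitary colligation with state matrix `T_μ*`. -/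
def matB (z₁ z₂ μ : ℂ) : Matrix (Fin 2) (Fin 2) ℂ :=
  !![-(Real.sqrt (1 - ‖z₁‖ ^ 2) : ℂ) * conj μ * z₂,
      (Real.sqrt (1 - ‖z₁‖ ^ 2) : ℂ) * (Real.sqrt (1 - ‖μ‖ ^ 2) : ℂ);
     (Real.sqrt (1 - ‖z₂‖ ^ 2) : ℂ), 0]

/-- The output operator of a unitary colligation with state matrix `T_μ*`. -/
def matC (z₁ z₂ μ : ℂ) : Matrix (Fin 2) (Fin 2) ℂ :=
  !![0, (Real.sqrt (1 - ‖μ‖ ^ 2) : ℂ) * (Real.sqrt (1 - ‖z₂‖ ^ 2) : ℂ);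
     (Real.sqrt (1 - ‖z₁‖ ^ 2) : ℂ), -z₁ * conj μ * (Real.sqrt (1 - ‖z₂‖ ^ 2) : ℂ)]

theorem isUnitaryColligation_matT (z₁ z₂ μ : ℂ) (hz₁ : ‖z₁‖ < 1) (hz₂ : ‖z₂‖ < 1) (hμ : ‖μ‖ ≤ 1) :
    IsUnitaryColligation (toOp (matT z₁ z₂ μ)) (toOp (matB z₁ z₂ μ)) (toOp (matC z₁ z₂ μ))
      (toOp (matTheta z₁ z₂ μ 0)) := by
  have h1 := sq_sqrt_one_sub_norm_sq hz₁.le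
  have h2 := sq_sqrt_one_sub_norm_sq hz₂.le
  have h3 := sq_sqrt_one_sub_norm_sq hμ
  -- The entrywise identities are polynomial, so conjugates and square roots become independent
  -- letters tied only by s² = 1 - w conj w.
  apply isUnitaryColligation_toOp <;>
    simp only [matT, matB, matC, matTheta, blaschke, star_fin_two, map_mul, map_neg, map_zero,
      map_sub, mul_zero, sub_zero, div_one, Complex.conj_ofReal,
      Complex.conj_conj] <;>
    clear hz₁ hz₂ hμ <;>
    generalize ((Real.sqrt (1 - ‖z₁‖ ^ 2) : ℝ) : ℂ) = s₁ at * <;>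
    generalize ((Real.sqrt (1 - ‖z₂‖ ^ 2) : ℝ) : ℂ) = s₂ at * <;>
    generalize ((Real.sqrt (1 - ‖μ‖ ^ 2) : ℝ) : ℂ) = m at * <;>
    generalize conj z₁ = w₁ at * <;> generalize conj z₂ = w₂ at * <;>
    generalize conj μ = ν at * <;>
    ext i j <;> fin_cases i <;> fin_cases j <;> simp <;> grind

theorem transferFun_matT (z₁ z₂ μ : ℂ) (hz₁ : ‖z₁‖ < 1) (hz₂ : ‖z₂‖ < 1) (z : ℂ) (hz : ‖z‖ < 1) :
    transferFun (toOp (matT z₁ z₂ μ)) (toOp (matB z₁ z₂ μ)) (toOp (matC z₁ z₂ μ))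
      (toOp (matTheta z₁ z₂ μ 0)) z = toOp (matTheta z₁ z₂ μ z) := by
  have h1 := sq_sqrt_one_sub_norm_sq hz₁.le
  have h2 := sq_sqrt_one_sub_norm_sq hz₂.le
  have p1 := one_sub_conj_mul_ne_zero hz₁ hz.le
  have p2 := one_sub_conj_mul_ne_zero hz₂ hz.le
  -- The explicit inverse of the upper triangular matrix 1 - z T_μ*.
  rw [transferFun_toOp (N := !![(1 - conj z₁ * z)⁻¹, z * conj μ * (Real.sqrt (1 - ‖z₁‖ ^ 2) : ℂ) *
    (Real.sqrt (1 - ‖z₂‖ ^ 2) : ℂ) * (1 - conj z₁ * z)⁻¹ * (1 - conj z₂ * z)⁻¹;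
    0, (1 - conj z₂ * z)⁻¹])]
  · congr 1
    ext i j
    fin_cases i <;> fin_cases j <;> simp [matB, matC, matTheta, blaschke] <;> grind
  · simp only [matT, star_fin_two]
    ext i j
    fin_cases i <;> fin_cases j <;> simp [Matrix.one_fin_two] <;> grind

theorem sqrt_one_sub_norm_sq_ne_zero {w : ℂ} (hw : ‖w‖ < 1) :
    Real.sqrt (1 - ‖w‖ ^ 2) ≠ 0 :=
  (Real.sqrt_pos.mpr (sub_pos.mpr (pow_lt_one₀ (norm_nonneg _) hw two_ne_zero))).ne'

end

end SzNagyFoias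

theorem mainTheorem8 (z₁ z₂ μ : ℂ) (hz₁ : ‖z₁‖ < 1) (hz₂ : ‖z₂‖ < 1) (hμ : ‖μ‖ ≤ 1) :
    SzNagyFoias.IsInner (fun z => SzNagyFoias.toOp (SzNagyFoias.matTheta z₁ z₂ μ z)) ∧
    ∃ hT : ‖SzNagyFoias.toOp (SzNagyFoias.matT z₁ z₂ μ)‖ ≤ 1,
      (‖μ‖ < 1 →
        SzNagyFoias.Coincide
          (SzNagyFoias.charFun (SzNagyFoias.toOp (SzNagyFoias.matT z₁ z₂ μ)) hT)
          (fun z => SzNagyFoias.toOp (SzNagyFoias.matTheta z₁ z₂ μ z))) ∧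
      ∃ (E₀ F₀ : Submodule ℂ (EuclideanSpace ℂ (Fin 2))) (Θ₀ : ℂ → E₀ →L[ℂ] F₀),
        SzNagyFoias.IsPurePart (fun z => SzNagyFoias.toOp (SzNagyFoias.matTheta z₁ z₂ μ z))
          E₀ F₀ Θ₀ ∧
        SzNagyFoias.Coincide (E' := E₀) (F' := F₀)
          (SzNagyFoias.charFun (SzNagyFoias.toOp (SzNagyFoias.matT z₁ z₂ μ)) hT) Θ₀ := by
  have h := SzNagyFoias.isUnitaryColligation_matT z₁ z₂ μ hz₁ hz₂ hμ
  have hθ := SzNagyFoias.transferFun_matT z₁ z₂ μ hz₁ hz₂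
  refine ⟨SzNagyFoias.isInner_matTheta z₁ z₂ μ hz₁ hz₂ hμ, h.norm_le_one, fun hμ' => ?_,
    _, _, h.pureTransferFun, h.isPurePart.congr hθ, h.coincide_charFun _⟩
  have h1 := SzNagyFoias.sqrt_one_sub_norm_sq_ne_zero hz₁
  have h2 := SzNagyFoias.sqrt_one_sub_norm_sq_ne_zero hz₂
  have h3 := SzNagyFoias.sqrt_one_sub_norm_sq_ne_zero hμ'
  -- Both det B and det C equal -m s₁ s₂, nonzero exactly because |μ| < 1 joins |z_i| < 1.
  refine (h.coincide_charFun_transferFun _ ?_ ?_).congr_right hθ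
  · rw [SzNagyFoias.adjoint_toOp]
    refine SzNagyFoias.closedRange_toOp_eq_top ?_
    rw [Matrix.star_eq_conjTranspose, Matrix.det_conjTranspose, star_ne_zero, Matrix.det_fin_two]
    simpa [SzNagyFoias.matB] using ⟨⟨h1, h3⟩, h2⟩
  · refine SzNagyFoias.closedRange_toOp_eq_top ?_
    rw [Matrix.det_fin_two]
    simpa [SzNagyFoias.matC] using ⟨⟨h3, h2⟩, h1⟩
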